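/- Let $H$ be a finite connected graph, multiple edges allowed but without loops, with vertices $v_1,\dots,v_m$; let $a_{ij}$ be the number of edges between $v_i$ and $v_j$, and $d_i=\sum_j a_{ij}$ the degree of $v_i$. For each $i$ let $S_i=\{s_{i,1}<\dots<s_{i,k_i}\}$ be a finite, possibly empty, set of positive integers; write $\max S_i=s_{i,k_i}$, with $\max\emptyset=0$, and $k_i=|S_i|$. For an integer $n\ge 1$ with $n>2\max S_i$ for all $i$, let $G_i=C_n(S_i)$ be the circulant graph on $\mathbb Z/n$ in which $k$ is adjacent to $k\pm s$ for $s\in S_i$, and let the circulant foliation $H_n=H_n(G_1,\dots,G_m)$ be the graph with vertex set $\mathbb Z/n\times\{v_1,\dots,v_m\}$ in which, for each fixed $k$ and $i\neq j$, the vertices $(k,v_i)$ and $(k,v_j)$ are joined by $a_{ij}$ edges and, for each fixed $i$, the vertices $(k,v_i)$, $k\in\mathbb Z/n$, form a copy of $G_i$. A rooted spanning forest of a graph is a spanning subgraph without cycles together with the choice of one vertex (root) in each of its connected components; let $f(n)$ be the number of rooted spanning forests of $H_n$. Let $T_k$ be the Chebyshev polynomials of the first kind and let $Q(w)=\det L(H,W)$,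 where $L(H,W)$ is the $m\times m$ matrix with off-diagonal entries $-a_{ij}$ and diagonal entries $2k_i+d_i+1-\sum_{s\in S_i}2T_s(w)$. Let $\eta$ be the determinant of the matrix, indexed by the vertices $v_i$ with $S_i=\emptyset$, with off-diagonal entries $-a_{ij}$ and diagonal entries $d_i+1$, where $d_i$ is the degree in $H$ (so $\eta=1$ if no $S_i$ is empty). Put $s=\sum_{i=1}^m\max S_i$. Then $\eta>0$, the integer polynomial $Q$ has degree $s$, and, if $w_1,\dots,w_s$ are all its complex roots, listed with multiplicity, then for every such $n$ $$f(n)=\eta^n\prod_{p=1}^{s}|2T_n(w_p)-2|.$$ -/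

import Mathlib

open scoped Graph Polynomial

noncomputable section

namespace Graph

variable {α β κ : Type*}

/-! ### Connectedness, cycles and rooted spanning forests in multigraphs -/

/-- `x` and `y` are joined by a walk in `G`. -/
def Reachable (G : Graph α β) (x y : α) : Prop := Relation.ReflTransGen G.Adj x y

/-- A multigraph is connected if it is non-empty and any two vertices are joined by a walk. -/
def Connected (G : Graph α β) : Prop :=
  V(G).Nonempty ∧ ∀ x ∈ V(G), ∀ y ∈ V(G), G.Reachable x y

/-- `v` and `e` are the vertices and the edges, both without repetition and in cyclic order, of a
cycle of length `ℓ` in `G`. A loop is a cycle of length `1`, and a pair of parallel edges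
is a cycle of length `2`. -/
def IsCycle (G : Graph α β) (ℓ : ℕ) (v : ZMod ℓ → α) (e : ZMod ℓ → β) : Prop :=
  1 ≤ ℓ ∧ v.Injective ∧ e.Injective ∧ ∀ i, G.IsLink (e i) (v i) (v (i + 1))

/-- A forest: a multigraph without cycles. Its connected components are trees. -/
def IsForest (G : Graph α β) : Prop :=
  ∀ (ℓ : ℕ) (v : ZMod ℓ → α) (e : ZMod ℓ → β), ¬ G.IsCycle ℓ v e

/-- `F`, with set of roots `R`, is a rooted spanning forest of `G`: `F` is a spanning subgraph
of `G` without cycles, and every connected component of `F` contains exactly one root. -/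
def IsRootedSpanningForest (G F : Graph α β) (R : Set α) : Prop :=
  F ≤s G ∧ F.IsForest ∧ R ⊆ V(F) ∧ ∀ x ∈ V(F), ∃! r, r ∈ R ∧ F.Reachable x r

/-- The number of rooted spanning forests of a (finite) multigraph `G`. -/
def numRootedSpanningForests (G : Graph α β) : ℕ :=
  {p : Graph α β × Set α | G.IsRootedSpanningForest p.1 p.2}.ncard

/-! ### Generalized Laplacian -/

/-- The number of edges between `x` and `y`. -/
def numEdges (G : Graph α β) (x y : α) : ℕ := {e | G.IsLink e x y}.ncard

/-- The degree of a vertex of a (loopless) multigraph. -/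
def deg (G : Graph α β) [Fintype V(G)] (x : α) : ℕ := ∑ y : V(G), G.numEdges x y

/-- The adjacency matrix of a multigraph. -/
def adjacencyMatrix (G : Graph α β) (R : Type*) [CommRing R] : Matrix V(G) V(G) R :=
  Matrix.of fun x y => (G.numEdges x y : R)

/-- The generalized Laplacian `L(G, X) = diag(X) - A(G)`. -/
def generalizedLaplacian [DecidableEq α] (G : Graph α β) {R : Type*} [CommRing R] (X : V(G) → R) :
    Matrix V(G) V(G) R :=
  Matrix.diagonal X - G.adjacencyMatrix R

/-! ### Circulant foliations -/

/-- The circulant graph `C_n(J)` with set of jumps `J`: the vertex `i` is adjacent to `i ± s`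
modulo `n` for `s ∈ J`. -/
def circulant (n : ℕ) (J : Finset ℕ) : SimpleGraph (ZMod n) :=
  SimpleGraph.circulantGraph ((fun s : ℕ => (s : ZMod n)) '' (J : Set ℕ))

/-- The foliation over `H` with fibre `Γ v` over the vertex `v`. The vertices are the
pairs `(k, v)` with `v` a vertex of `H`; each edge `e` of `H` between `v` and `w` gives, for every
`k`, an edge `Sum.inl (k, e)` between `(k, v)` and `(k, w)`; and each edge `{k, l}` of `Γ v` gives
an edge `Sum.inr (v, s(k, l))` between `(k, v)` and `(l, v)`. -/
def foliation (H : Graph α β) (Γ : α → SimpleGraph κ) :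
    Graph (κ × α) ((κ × β) ⊕ (α × Sym2 κ)) where
  vertexSet := {p | p.2 ∈ V(H)}
  IsLink e p q :=
    match e with
    | Sum.inl (k, e) => p.1 = k ∧ q.1 = k ∧ H.IsLink e p.2 q.2
    | Sum.inr (v, z) =>
        v ∈ V(H) ∧ p.2 = v ∧ q.2 = v ∧ z = s(p.1, q.1) ∧ (Γ v).Adj p.1 q.1
  isLink_symm := by
    rintro (⟨k, e⟩ | ⟨v, z⟩) -
    · exact ⟨fun p q h => ⟨h.2.1, h.1, h.2.2.symm⟩⟩
    · exact ⟨fun p q h => ⟨h.1, h.2.2.1, h.2.1, h.2.2.2.1.trans Sym2.eq_swap, h.2.2.2.2.symm⟩⟩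
  eq_or_eq_of_isLink_of_isLink := by
    rintro (⟨k, e⟩ | ⟨v, z⟩) ⟨p₁, p₂⟩ ⟨q₁, q₂⟩ ⟨p₁', p₂'⟩ ⟨q₁', q₂'⟩ h h'
    · obtain ⟨rfl, rfl, h⟩ := h
      obtain ⟨rfl, h₁, h'⟩ := h'
      rcases h.left_eq_or_eq h' with h₂ | h₂
      · exact Or.inl (Prod.ext rfl h₂)
      · exact Or.inr (Prod.ext h₁.symm h₂)
    · obtain ⟨-, h₁, -, hz, -⟩ := h
      obtain ⟨-, h₁', h₂', hz', -⟩ := h'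
      rcases Sym2.eq_iff.mp (hz.symm.trans hz') with ⟨h₃, -⟩ | ⟨h₃, -⟩
      · exact Or.inl (Prod.ext h₃ (h₁.trans h₁'.symm))
      · exact Or.inr (Prod.ext h₃ (h₁.trans h₂'.symm))
  left_mem_of_isLink := by
    rintro (⟨k, e⟩ | ⟨v, z⟩) p q h
    · exact h.2.2.left_mem
    · obtain ⟨hv, rfl, -⟩ := h
      exact hv

/-- The circulant foliation `H_n(G_1, …, G_m)` over `H`, where the fibre over the vertex `v` is
the circulant graph `C_n(S v)`. -/
def circulantFoliation (H : Graph α β) (n : ℕ) (S : α → Finset ℕ) :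
    Graph (ZMod n × α) ((ZMod n × β) ⊕ (α × Sym2 (ZMod n))) :=
  H.foliation fun v => circulant n (S v)

/-! ### The ingredients of the formula -/

/-- The polynomial `Q(w) = det L(H, W)`, where the diagonal entry at `v` is
`2 k_v + d_v + 1 - ∑ 2 T_s(w)`, the sum over the `k_v` jumps `s` of the fibre over `v`. -/
def Q [DecidableEq α] (H : Graph α β) [Fintype V(H)] (S : α → Finset ℕ) : ℤ[X] :=
  (H.generalizedLaplacian fun v : V(H) =>
    (2 * ((S v).card : ℤ[X]) + (H.deg v : ℤ[X]) + 1
      - ∑ s ∈ S v, 2 * Polynomial.Chebyshev.T ℤ (s : ℤ))).det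

/-- The subgraph `H'` of `H` induced by the vertices with empty fibres. -/
def emptyFibreSubgraph (H : Graph α β) (S : α → Finset ℕ) : Graph α β :=
  H.induce {v | v ∈ V(H) ∧ S v = ∅}

instance fintypeEmptyFibreSubgraph (H : Graph α β) [Fintype V(H)] (S : α → Finset ℕ) :
    Fintype V(H.emptyFibreSubgraph S) :=
  Fintype.ofInjective (fun v => (⟨v.1, v.2.1⟩ : V(H))) fun _ _ h =>
    Subtype.ext (congrArg (fun x : V(H) => x.1) h)

/-- `η = det L(H', X')`, where the diagonal entry at a vertex of `H'` is one plus its degree in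
the whole graph `H`. It is `1` if `H'` has no vertices. -/
def eta [DecidableEq α] (H : Graph α β) [Fintype V(H)] (S : α → Finset ℕ) : ℤ :=
  ((H.emptyFibreSubgraph S).generalizedLaplacian fun v => (H.deg v : ℤ) + 1).det

/-- The sum over the vertices of `H` of the largest jump of the fibre (`0` for an empty fibre). -/
def sumMaxJumps (H : Graph α β) [Fintype V(H)] (S : α → Finset ℕ) : ℕ :=
  ∑ v : V(H), (S v).sup id

end Graph

end

/-! By the matrix forest theorem (`numRootedSpanningForests_eq_det`), rooted spanning forests are
counted by `det (1 + L)`, where `L` is the Laplacian. For the circulant foliation this matrix is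
block circulant, and the discrete Fourier transform on `ZMod n` block diagonalizes it
(`det_eq_prod_det_of_fourier`). With `ζ = exp (2πi/n)`, a jump `s` acts on the `j`-th character by
`ζ^(js) + ζ^(-js) = 2 T_s(cos (2πj/n))`, so the `j`-th block is `L(H, W)` at `w = cos (2πj/n)` and
`f(n) = ∏_j Q(cos (2πj/n))`.

Factoring `Q` over its roots `w_p` and exchanging the products leaves `|lc Q|^n ∏_p ∏_j |w_p - cos
(2πj/n)|`. Two facts finish the proof: `2 T_n(w) - 2 = 2^n ∏_j (w - cos (2πj/n))`, and `|lc Q| = 2^s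
η`, read off from the top coefficients of the rows (`natDegree_Q_le_and_coeff`). The powers of two
cancel.

The matrix forest theorem comes from multilinearity. Row `v` of `1 + L` is `e_v` plus a sum of `e_v
- e_y` over the edges from `v` to `y`; picking one summand per row declares each vertex a root or
gives it a parent. The resulting determinant is `1` if passing to parents always stops and `0`
otherwise. The terminating choices correspond to rooted spanning forests by means of the depth below
the roots. The same expansion, with nonnegative weights, gives `η > 0`. -/

noncomputable section

/-! ### Depth functions and rooted spanning forests. -/

namespace Graph

variable {α β : Type*}

/-- `h` measures the depth below the roots `R` in `F`: every edge of `F` changes `h` by one, and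
the vertices outside `R` are those having an edge to a vertex of smaller depth, which is then
unique. -/
structure IsDepth (F : Graph α β) (R : Set α) (h : α → ℕ) : Prop where
  root : ∀ x ∈ R, h x = 0
  parent : ∀ x ∈ V(F), x ∉ R → ∃ e y, F.IsLink e x y ∧ h x = h y + 1
  unique : ∀ ⦃x e y e' y'⦄, F.IsLink e x y → h x = h y + 1 → F.IsLink e' x y' →
    h x = h y' + 1 → e = e'
  step : ∀ ⦃e x y⦄, F.IsLink e x y → h x = h y + 1 ∨ h y = h x + 1

variable {F G : Graph α β} {R : Set α} {h h' : α → ℕ}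

/-- At a vertex of maximal depth on a cycle both cycle edges descend, so they coincide by
uniqueness. The cycle would then be a loop, which cannot change the depth by one. -/
theorem IsDepth.isForest (hd : F.IsDepth R h) : F.IsForest := by
  rintro ℓ v e ⟨hℓ, -, he, hlink⟩
  have : NeZero ℓ := ⟨by omega⟩
  obtain ⟨i, hi⟩ := Finite.exists_max fun i => h (v i)
  have h₁ : h (v i) = h (v (i + 1)) + 1 := by
    have := hi (i + 1)
    have := hd.step (hlink i)
    omega
  have hl := hlink (i - 1)
  rw [sub_add_cancel] at hl
  have h₂ : h (v i) = h (v (i - 1)) + 1 := by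
    have := hi (i - 1)
    have := hd.step hl
    omega
  have h₃ : i = i - 1 := he (hd.unique (hlink i) h₁ hl.symm h₂)
  rw [← h₃] at h₂
  omega

/-- `y` is reached from `x` by a walk along which the depth decreases. -/
def Descends (F : Graph α β) (h : α → ℕ) : α → α → Prop :=
  Relation.ReflTransGen fun x y => ∃ e, F.IsLink e x y ∧ h x = h y + 1

theorem IsDepth.exists_descends (hd : F.IsDepth R h) {x : α} (hx : x ∈ V(F)) :
    ∃ r ∈ R, F.Descends h x r := by
  induction hn : h x using Nat.strong_induction_on generalizing x with
  | _ n ih =>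
    by_cases hxR : x ∈ R
    · exact ⟨x, hxR, .refl⟩
    · obtain ⟨e, y, he, hy⟩ := hd.parent x hx hxR
      obtain ⟨r, hr, hyr⟩ := ih (h y) (by omega) he.right_mem rfl
      exact ⟨r, hr, .head ⟨e, he, hy⟩ hyr⟩

theorem Descends.reachable {x y : α} (hxy : F.Descends h x y) : F.Reachable x y :=
  Relation.ReflTransGen.mono (fun _ _ ⟨e, he, _⟩ => ⟨e, he⟩) _ _ hxy

/-- Induction from the root end of the walk. If the first step goes up from `x` to `y`, the
descending walk from `y` must start with the unique descending edge at `y`, which leads back to `x`;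
deleting this detour leaves a descending walk from `x`. -/
theorem IsDepth.descends_of_reachable (hd : F.IsDepth R h) {x r : α} (hr : r ∈ R)
    (hxr : F.Reachable x r) : F.Descends h x r := by
  induction hxr using Relation.ReflTransGen.head_induction_on with
  | refl => exact .refl
  | head hxy _ ih =>
    obtain ⟨e, he⟩ := hxy
    rcases hd.step he with hlt | hlt
    · exact .head ⟨e, he, hlt⟩ ih
    · rcases Relation.ReflTransGen.cases_head ih with rfl | ⟨z, ⟨e', he', hz⟩, hzr⟩
      · have := hd.root _ hr
        omega
      · obtain rfl := hd.unique he.symm hlt he' hz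
        rwa [he.symm.right_unique he']

/-- Descent is deterministic, so one of the two walks continues the other; a root has depth `0` and
admits no further descent. -/
theorem IsDepth.descends_unique (hd : F.IsDepth R h) {x r r' : α} (hr : r ∈ R) (hr' : r' ∈ R)
    (hxr : F.Descends h x r) (hxr' : F.Descends h x r') : r = r' := by
  have hmin : ∀ {r y}, r ∈ R → F.Descends h r y → r = y := by
    intro r y hr hry
    rcases Relation.ReflTransGen.cases_head hry with rfl | ⟨z, ⟨e', he', hz⟩, -⟩
    · rfl
    · have := hd.root _ hr
      omega
  have hru : Relator.RightUnique fun x y => ∃ e, F.IsLink e x y ∧ h x = h y + 1 := by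
    rintro x y z ⟨e, he, hy⟩ ⟨e', he', hz⟩
    obtain rfl := hd.unique he hy he' hz
    exact he.right_unique he'
  rcases Relation.ReflTransGen.total_of_right_unique hru hxr hxr' with hrr | hrr
  · exact hmin hr hrr
  · exact (hmin hr' hrr).symm

/-- A spanning subgraph with a depth function is a rooted spanning forest. -/
theorem IsDepth.isRootedSpanningForest (hd : F.IsDepth R h) (hF : F ≤s G) (hR : R ⊆ V(F)) :
    G.IsRootedSpanningForest F R := by
  refine ⟨hF, hd.isForest, hR, fun x hx => ?_⟩
  obtain ⟨r, hr, hxr⟩ := hd.exists_descends hx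
  exact ⟨r, ⟨hr, hxr.reachable⟩, fun r' ⟨hr', hxr'⟩ =>
    hd.descends_unique hr' hr (hd.descends_of_reachable hr' hxr') hxr⟩

/-- Follow the parents for `h'` up to a root: `h'` drops by exactly one at each step, while `h`
changes by one in either direction. By symmetry the depth is determined by `F` and `R`. -/
theorem IsDepth.le (hd : F.IsDepth R h) (hd' : F.IsDepth R h') {x : α} (hx : x ∈ V(F)) :
    h x ≤ h' x := by
  induction hn : h' x using Nat.strong_induction_on generalizing x with
  | _ n ih =>
    by_cases hxR : x ∈ R
    · simp [hd.root x hxR]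
    · obtain ⟨e, y, he, hy⟩ := hd'.parent x hx hxR
      have := ih (h' y) (by omega) he.right_mem rfl
      have := hd.step he
      omega

theorem IsDepth.eq (hd : F.IsDepth R h) (hd' : F.IsDepth R h') {x : α} (hx : x ∈ V(F)) :
    h x = h' x :=
  (hd.le hd' hx).antisymm (hd'.le hd hx)

/-- Adjacency in `F` by means of an edge different from `e`. -/
def adjAvoiding (F : Graph α β) (e : β) : SimpleGraph α :=
  SimpleGraph.mk (fun x y => x ≠ y ∧ ∃ e', e' ≠ e ∧ F.IsLink e' x y)
    ⟨fun _ _ ⟨hne, e', he', hl⟩ => ⟨hne.symm, e', he', hl.symm⟩⟩ ⟨fun _ hx => hx.1 rfl⟩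

/-- In a forest, the ends of an edge are separated by its removal. -/
theorem IsForest.not_reachable_adjAvoiding (hF : F.IsForest) {e : β} {x y : α}
    (he : F.IsLink e x y) : ¬ (F.adjAvoiding e).Reachable x y := by
  intro hxy
  obtain ⟨p, hp⟩ := hxy.exists_isPath
  have hadj : ∀ i, i < p.length →
      ∃ e', e' ≠ e ∧ F.IsLink e' (p.getVert i) (p.getVert (i + 1)) :=
    fun i hi => (p.adj_getVert_succ hi).2
  have : Nonempty β := ⟨e⟩
  choose! f hfe hf using hadj
  have hinj := hp.getVert_injOn
  have hfinj : ∀ i j, i < p.length → j < p.length → f i = f j → i = j := by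
    intro i j hi hj hij
    have h₁ := hf i hi
    rw [hij] at h₁
    rcases h₁.eq_and_eq_or_eq_and_eq (hf j hj) with ⟨h₂, -⟩ | ⟨h₂, h₃⟩
    · exact hinj (by simp; omega) (by simp; omega) h₂
    · have := hinj (by simp; omega) (by simp; omega) h₂
      have := hinj (by simp; omega) (by simp; omega) h₃
      omega
  -- The path from `x` to `y` is closed up by `e`, placed at the last index `p.length`.
  refine hF (p.length + 1) (fun i => p.getVert i.val)
    (fun i => if i.val < p.length then f i.val else e) ⟨by omega, ?_, ?_, ?_⟩
  · intro i j hij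
    have hi := i.val_lt
    have hj := j.val_lt
    exact ZMod.val_injective _ (hinj (by simp; omega) (by simp; omega) hij)
  · intro i j hij
    have hi := i.val_lt
    have hj := j.val_lt
    apply ZMod.val_injective
    dsimp only at hij
    split_ifs at hij with h₁ h₂ h₂
    · exact hfinj _ _ h₁ h₂ hij
    · exact absurd hij (hfe _ h₁)
    · exact absurd hij.symm (hfe _ h₂)
    · omega
  · intro i
    have hi := i.val_lt
    by_cases hlt : i.val < p.length
    · have : (i + 1).val = i.val + 1 := by
        have h1 : (1 : ZMod (p.length + 1)).val = 1 := ZMod.val_one'' (by omega)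
        rw [ZMod.val_add_of_lt (by omega), h1]
      simpa [hlt, this] using hf _ hlt
    · have hi' : i.val = p.length := by omega
      have h0 : i + 1 = 0 := by
        rw [← ZMod.natCast_zmod_val i, hi', ← Nat.cast_succ]
        exact ZMod.natCast_self _
      simpa [hi', h0] using he.symm

/-- `x` is joined to `R` by a walk of length `n` in `F`. -/
def WalkTo (F : Graph α β) (R : Set α) : ℕ → α → Prop
  | 0, x => x ∈ R
  | n + 1, x => ∃ e y, F.IsLink e x y ∧ F.WalkTo R n y

theorem exists_walkTo {x r : α} (hr : r ∈ R) (hxr : F.Reachable x r) : ∃ n, F.WalkTo R n x := by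
  induction hxr using Relation.ReflTransGen.head_induction_on with
  | refl => exact ⟨0, hr⟩
  | head hxy _ ih =>
    obtain ⟨e, he⟩ := hxy
    obtain ⟨n, hn⟩ := ih
    exact ⟨n + 1, e, _, he, hn⟩

/-- The distance to the roots is a depth function of a rooted spanning forest. -/
theorem IsRootedSpanningForest.exists_isDepth (hF : G.IsRootedSpanningForest F R) :
    ∃ h, F.IsDepth R h := by
  obtain ⟨-, hforest, hRV, hroot⟩ := hF
  have hne : ∀ x ∈ V(F), {n | F.WalkTo R n x}.Nonempty := by
    intro x hx
    obtain ⟨r, ⟨hr, hxr⟩, -⟩ := hroot x hx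
    exact exists_walkTo hr hxr
  set h : α → ℕ := fun x => sInf {n | F.WalkTo R n x} with hh
  have hzero : ∀ x ∈ R, h x = 0 := fun x hx => Nat.sInf_eq_zero.mpr (Or.inl hx)
  have hle : ∀ ⦃e x y⦄, F.IsLink e x y → h x ≤ h y + 1 := fun e x y he =>
    Nat.sInf_le (show F.WalkTo R (h y + 1) x from
      ⟨e, y, he, Nat.sInf_mem (hne y he.right_mem)⟩)
  have hparent : ∀ x ∈ V(F), x ∉ R → ∃ e y, F.IsLink e x y ∧ h x = h y + 1 := by
    intro x hx hxR
    have hmem : F.WalkTo R (h x) x := Nat.sInf_mem (hne x hx)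
    obtain ⟨n, hn⟩ : ∃ n, h x = n + 1 := by
      refine Nat.exists_eq_succ_of_ne_zero fun h0 => hxR ?_
      rwa [h0] at hmem
    rw [hn] at hmem
    obtain ⟨e, y, he, hy⟩ := hmem
    have h₁ : h y ≤ n := Nat.sInf_le hy
    have h₂ := hle he
    exact ⟨e, y, he, by omega⟩
  -- `choose!` needs a default edge.
  cases isEmpty_or_nonempty β
  · exact ⟨h, hzero, hparent, fun _ e => isEmptyElim e, fun e => isEmptyElim e⟩
  choose! pe py hp hph using hparent
  -- Every edge is the parent edge of some vertex. Otherwise the parent walks from both ends of `e`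
  -- avoid `e` and end at the same root, so the ends of `e` stay connected without it, which is
  -- impossible in a forest.
  have hmem : ∀ ⦃e x y⦄, F.IsLink e x y → ∃ z ∈ V(F), z ∉ R ∧ e = pe z := by
    intro e a b he
    by_contra! hcon
    have hreach : ∀ x ∈ V(F), ∃ r ∈ R, (F.adjAvoiding e).Reachable x r ∧ F.Reachable x r := by
      intro x hx
      induction hn : h x using Nat.strong_induction_on generalizing x with
      | _ n ih =>
        by_cases hxR : x ∈ R
        · exact ⟨x, hxR, .refl x, .refl⟩
        · have hl := hp x hx hxR
          have hlt := hph x hx hxR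
          obtain ⟨r, hr, h₁, h₂⟩ := ih (h (py x)) (by omega) _ hl.right_mem rfl
          have hadj : (F.adjAvoiding e).Adj x (py x) :=
            ⟨fun h0 => by rw [← h0] at hlt; omega, pe x, (hcon x hx hxR).symm, hl⟩
          exact ⟨r, hr, hadj.reachable.trans h₁, .head ⟨_, hl⟩ h₂⟩
    obtain ⟨r, hr, h₁, h₂⟩ := hreach a he.left_mem
    obtain ⟨r', hr', h₁', h₂'⟩ := hreach b he.right_mem
    obtain rfl : r = r' :=
      (hroot a he.left_mem).unique ⟨hr, h₂⟩ ⟨hr', .head ⟨_, he⟩ h₂'⟩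
    exact hforest.not_reachable_adjAvoiding he (h₁.trans h₁'.symm)
  have hdown : ∀ ⦃e x y⦄, F.IsLink e x y → h x = h y + 1 → e = pe x := by
    intro e x y he hxy
    obtain ⟨z, hz, hzR, rfl⟩ := hmem he
    have hlt := hph z hz hzR
    rcases he.eq_and_eq_or_eq_and_eq (hp z hz hzR) with ⟨rfl, -⟩ | ⟨rfl, rfl⟩
    · rfl
    · omega
  refine ⟨h, hzero, fun x hx hxR => ⟨_, _, hp x hx hxR, hph x hx hxR⟩,
    fun x e y e' y' he hy he' hy' => (hdown he hy).trans (hdown he' hy').symm, ?_⟩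
  intro e x y he
  obtain ⟨z, hz, hzR, rfl⟩ := hmem he
  have hlt := hph z hz hzR
  rcases he.eq_and_eq_or_eq_and_eq (hp z hz hzR) with ⟨rfl, rfl⟩ | ⟨rfl, rfl⟩
  · exact .inl hlt
  · exact .inr hlt

end Graph

end

/-! ### Determinants of partial functions. -/

noncomputable section

namespace Graph

variable {V ι R : Type*} [Fintype V] [DecidableEq V] [CommRing R]

/-- `h` is a depth function for the partial function `f`: applying `f` decreases `h`. -/
def IsRank (f : V → Option V) (h : V → ℕ) : Prop :=
  ∀ v, ((f v).elim (h v = 0) fun w => h v = h w + 1)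

/-- The matrix of `1 - f` for a partial function `f`. -/
def stepMatrix (R : Type*) [CommRing R] (f : V → Option V) : Matrix V V R :=
  Matrix.of fun v => Pi.single v 1 - (f v).elim 0 fun w => Pi.single w 1

omit [Fintype V] [DecidableEq V] in
theorem exists_isRank_of_wellFounded {f : V → Option V}
    (hf : WellFounded fun w v => f v = some w) : ∃ h, IsRank f h := by
  refine ⟨hf.fix fun v ih => match hv : f v with
    | none => 0
    | some w => ih w hv + 1, fun v => ?_⟩
  rw [hf.fix_eq]
  split <;> rename_i hv <;> simp [hv]

theorem det_stepMatrix_of_isRank {f : V → Option V} {h : V → ℕ} (hf : IsRank f h) :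
    (stepMatrix R f).det = 1 := by
  have hentry : ∀ v w, h v ≤ h w → stepMatrix R f v w = (1 : Matrix V V R) v w := by
    intro v w hvw
    have hv := hf v
    rw [stepMatrix, Matrix.of_apply, Matrix.one_apply, Pi.sub_apply, Pi.single_apply]
    rcases hfv : f v with _ | u
    · simp [eq_comm]
    · rw [hfv] at hv
      have huw : w ≠ u := by rintro rfl; simp at hv; omega
      simp [eq_comm, huw]
  -- Off the diagonal, row `v` is supported at `f v`, which has smaller rank; the order is reversed
  -- to fit the convention of `BlockTriangular`.
  have htri : (stepMatrix R f).BlockTriangular (OrderDual.toDual ∘ h) := by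
    intro v w hvw
    have hlt : h v < h w := hvw
    rw [hentry v w hlt.le, Matrix.one_apply_ne]
    rintro rfl
    omega
  rw [htri.det]
  refine Finset.prod_eq_one fun k _ => ?_
  have : (stepMatrix R f).toSquareBlock (OrderDual.toDual ∘ h) k = 1 := by
    ext ⟨v, hv⟩ ⟨w, hw⟩
    have : h v ≤ h w := le_of_eq (OrderDual.toDual.injective (hv.trans hw.symm))
    simp [Matrix.toSquareBlock_def, hentry v w this, Matrix.one_apply]
  rw [this, Matrix.det_one]

/-- The indicator function of the vertices from which iteration never stops is a nonzero kernel
vector: it takes the same value at `v` and `f v`, and vanishes where `f` is undefined. -/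
theorem det_stepMatrix_of_not_isRank [IsDomain R] {f : V → Option V} (hf : ¬ ∃ h, IsRank f h) :
    (stepMatrix R f).det = 0 := by
  classical
  have hwf : ¬ WellFounded fun w v => f v = some w := fun h => hf (exists_isRank_of_wellFounded h)
  obtain ⟨u, hu⟩ : ∃ u, ¬ Acc (fun w v => f v = some w) u := by
    by_contra! hacc
    exact hwf ⟨hacc⟩
  refine Matrix.exists_mulVec_eq_zero_iff.mp
    ⟨fun v => if Acc (fun w v => f v = some w) v then 0 else 1,
      fun h0 => by simpa [hu] using congrFun h0 u, ?_⟩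
  ext v
  rcases hfv : f v with _ | w
  · have : Acc (fun w v => f v = some w) v := ⟨v, fun y hy => by simp [hfv] at hy⟩
    simp [Matrix.mulVec, stepMatrix, hfv, this]
  · have : Acc (fun w v => f v = some w) v ↔ Acc (fun w v => f v = some w) w :=
      ⟨fun h => h.inv hfv, fun h => ⟨v, fun y hy => by
        rw [hfv] at hy
        cases hy
        exact h⟩⟩
    change (Pi.single v 1 - (f v).elim 0 fun w => Pi.single w 1) ⬝ᵥ _ = (0 : R)
    rw [hfv, Option.elim_some, sub_dotProduct, single_dotProduct, single_dotProduct]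
    simp [this]

open Classical in
/-- The determinant of a matrix whose rows are weighted sums of rows `e_v - e_w` and `e_v`. -/
theorem det_sum_smul_stepMatrix [IsDomain R] [Fintype ι] (t : ι → Option V) (c : V → ι → R) :
    (Matrix.of fun v => ∑ i, c v i • (Pi.single v 1 - (t i).elim 0 fun w => Pi.single w 1 :
      V → R)).det =
      ∑ g : V → ι, (∏ v, c v (g v)) * if ∃ h, IsRank (fun v => t (g v)) h then 1 else 0 := by
  have := (Matrix.detRowAlternating (n := V) (R := R)).toMultilinearMap.map_sum
    (fun v i => c v i • (Pi.single v 1 - (t i).elim 0 fun w => Pi.single w 1 : V → R))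
  refine this.trans (Finset.sum_congr rfl fun g _ => ?_)
  rw [MultilinearMap.map_smul_univ, smul_eq_mul]
  congr 1
  change (stepMatrix R fun v => t (g v)).det = _
  split_ifs with hg
  · exact det_stepMatrix_of_isRank hg.choose_spec
  · exact det_stepMatrix_of_not_isRank hg

end Graph

end

/-! ### Parent choices and the matrix forest theorem. -/

noncomputable section

namespace Graph

variable {α β : Type*} {G : Graph α β}

/-- A choice of parents: each vertex is a root or has a parent, joined to it by a chosen edge, and
iterating the passage to the parent ends at a root. -/
structure IsParentChoice (g : V(G) → Option (E(G) × V(G))) : Prop where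
  isLink : ∀ v e y, g v = some (e, y) → G.IsLink e v y
  exists_isRank : ∃ h, IsRank (fun v => (g v).map Prod.snd) h

/-- The edges and the roots of a choice of parents. -/
def rootedSubgraph (g : V(G) → Option (E(G) × V(G))) : Graph α β × Set α :=
  (G.restrict {e | ∃ v e' y, g v = some (e', y) ∧ e'.1 = e},
    {x | ∃ hx : x ∈ V(G), g ⟨x, hx⟩ = none})

/-- A function on vertices extended by zero. -/
def extendRank (h : V(G) → ℕ) : α → ℕ := Function.extend Subtype.val h 0

@[simp]
theorem extendRank_apply (h : V(G) → ℕ) (v : V(G)) : extendRank h v = h v :=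
  Subtype.val_injective.extend_apply h 0 v

variable {g g' : V(G) → Option (E(G) × V(G))}

theorem IsRank.eq_of_parent {h : V(G) → ℕ} (hh : IsRank (fun v => (g v).map Prod.snd) h)
    {v y : V(G)} {e : E(G)} (hv : g v = some (e, y)) : h v = h y + 1 := by
  simpa [hv] using hh v

/-- Each edge of the subgraph joins a vertex to its parent, where the rank drops by one; hence an
edge descending from `x` can only be the parent edge of `x`. -/
theorem IsParentChoice.isDepth (hg : IsParentChoice g) {h : V(G) → ℕ}
    (hh : IsRank (fun v => (g v).map Prod.snd) h) :
    (rootedSubgraph g).1.IsDepth (rootedSubgraph g).2 (extendRank h) := by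
  have hrank := fun {v y e} => IsRank.eq_of_parent (v := v) (y := y) (e := e) hh
  have hedge : ∀ ⦃e x y⦄, (rootedSubgraph g).1.IsLink e x y →
      ∃ (v : V(G)) (e' : E(G)) (z : V(G)), g v = some (e', z) ∧ e'.1 = e ∧
        ((x = v ∧ y = z) ∨ (x = z ∧ y = v)) := by
    rintro e x y ⟨⟨v, e', z, hv, rfl⟩, hl⟩
    exact ⟨v, e', z, hv, rfl, hl.eq_and_eq_or_eq_and_eq (hg.isLink _ _ _ hv)⟩
  have hdown : ∀ ⦃e x y⦄, (rootedSubgraph g).1.IsLink e x y →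
      extendRank h x = extendRank h y + 1 →
      ∃ (v : V(G)) (e' : E(G)) (z : V(G)), g v = some (e', z) ∧ e'.1 = e ∧ x = v := by
    intro e x y hl hxy
    obtain ⟨v, e', z, hv, he, ⟨rfl, rfl⟩ | ⟨rfl, rfl⟩⟩ := hedge hl
    · exact ⟨v, e', z, hv, he, rfl⟩
    · have := hrank hv
      simp only [extendRank_apply] at hxy
      omega
  refine ⟨?_, ?_, ?_, ?_⟩
  · rintro x ⟨hx, hgx⟩
    simpa [hgx, ← extendRank_apply h ⟨x, hx⟩] using hh ⟨x, hx⟩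
  · intro x hx hxR
    have hx' : x ∈ V(G) := hx
    rcases hgx : g ⟨x, hx'⟩ with _ | ⟨e, y⟩
    · exact absurd ⟨hx', hgx⟩ hxR
    · refine ⟨e, y, ⟨⟨_, _, _, hgx, rfl⟩, hg.isLink _ _ _ hgx⟩, ?_⟩
      change extendRank h (⟨x, hx'⟩ : V(G)) = _
      rw [extendRank_apply, extendRank_apply]
      exact hrank hgx
  · intro x e y e' y' hl hy hl' hy'
    obtain ⟨v, d, z, hv, rfl, rfl⟩ := hdown hl hy
    obtain ⟨v', d', z', hv', rfl, hvv⟩ := hdown hl' hy'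
    obtain rfl := Subtype.ext hvv
    rw [hv] at hv'
    simp_all
  · intro e x y hl
    obtain ⟨v, e', z, hv, he, ⟨rfl, rfl⟩ | ⟨rfl, rfl⟩⟩ := hedge hl
    · simp [hrank hv]
    · simp [hrank hv]

theorem IsParentChoice.isRootedSpanningForest (hg : IsParentChoice g) :
    G.IsRootedSpanningForest (rootedSubgraph g).1 (rootedSubgraph g).2 :=
  (hg.isDepth hg.exists_isRank.choose_spec).isRootedSpanningForest
    ⟨restrict_le, rfl⟩ fun _ hx => hx.1

/-- The forest determines the depth (`IsDepth.eq`), and the depth determines the parent edge of a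
non-root as its unique descending edge. -/
theorem injOn_rootedSubgraph :
    Set.InjOn (rootedSubgraph (G := G)) {g | IsParentChoice g} := by
  intro g hg g' hg' hgg
  obtain ⟨h, hh⟩ := hg.exists_isRank
  obtain ⟨h', hh'⟩ := hg'.exists_isRank
  have hd := hg.isDepth hh
  have hd' := hg'.isDepth hh'
  rw [← hgg] at hd'
  have hmem : ∀ v : V(G), g v = none ↔ g' v = none := by
    intro v
    have := congrArg (fun p : Graph α β × Set α => v.1 ∈ p.2) hgg
    simpa [rootedSubgraph] using this
  funext v
  rcases hv : g v with _ | ⟨e, y⟩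
  · exact ((hmem v).mp hv).symm
  rcases hv' : g' v with _ | ⟨e', y'⟩
  · rw [(hmem v).mpr hv'] at hv
    cases hv
  have hl : (rootedSubgraph g).1.IsLink e v y := ⟨⟨_, _, _, hv, rfl⟩, hg.isLink _ _ _ hv⟩
  have hl' : (rootedSubgraph g).1.IsLink e' v y' := by
    rw [hgg]
    exact ⟨⟨_, _, _, hv', rfl⟩, hg'.isLink _ _ _ hv'⟩
  have heq : ∀ w : V(G), h w = h' w := fun w => by
    simpa using hd.eq hd' (x := w.1) w.2
  have hy := IsRank.eq_of_parent hh hv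
  have hy' := IsRank.eq_of_parent hh' hv'
  have hee := hd.unique hl (by simpa using hy) hl' (by simpa [heq] using hy')
  rw [← hee] at hl'
  rw [Subtype.ext hee, Subtype.ext (hl.right_unique hl')]

theorem IsRootedSpanningForest.exists_parentChoice {F : Graph α β} {R : Set α}
    (hF : G.IsRootedSpanningForest F R) :
    ∃ g : V(G) → Option (E(G) × V(G)), IsParentChoice g ∧ rootedSubgraph g = (F, R) := by
  classical
  obtain ⟨h, hd⟩ := hF.exists_isDepth
  obtain ⟨⟨hle, hV⟩, -, hRV, -⟩ := hF
  have hpar : ∀ v : V(G), v.1 ∉ R → ∃ p : E(G) × V(G), F.IsLink p.1 v p.2 ∧ h v = h p.2 + 1 := by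
    intro v hv
    obtain ⟨e, y, hl, hy⟩ := hd.parent v (by rw [hV]; exact v.2) hv
    exact ⟨(⟨e, (hl.mono hle).edge_mem⟩, ⟨y, (hl.mono hle).right_mem⟩), hl, hy⟩
  choose p hp hph using hpar
  have hsome : ∀ v e y, (if hv : v.1 ∈ R then none else some (p v hv)) = some (e, y) →
      F.IsLink e v y ∧ h v = h y + 1 := by
    intro v e y hv
    split_ifs at hv with hvR
    have hl := hp v hvR
    have hy := hph v hvR
    rw [Option.some.inj hv] at hl hy
    exact ⟨hl, hy⟩
  refine ⟨fun v => if hv : v.1 ∈ R then none else some (p v hv),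
    ⟨fun v e y hv => (hsome v e y hv).1.mono hle, fun v => h v, fun v => ?_⟩, ?_⟩
  · by_cases hv : v.1 ∈ R
    · simpa [hv] using hd.root v hv
    · simpa [hv] using hph v hv
  refine Prod.ext (Graph.ext ?_ fun e x y => ?_) (Set.ext fun x => ?_)
  · exact hV.symm
  · constructor
    · rintro ⟨⟨v, e', z, hv, rfl⟩, hl⟩
      exact (hle.isLink_iff (hsome _ _ _ hv).1.edge_mem).mpr hl
    · intro hl
      have key : ∀ {x y}, F.IsLink e x y → h x = h y + 1 →
          ∃ (v : V(G)) (e' : E(G)) (z : V(G)),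
            (if hv : v.1 ∈ R then none else some (p v hv)) = some (e', z) ∧ e'.1 = e := by
        intro x y hl hxy
        have hxR : x ∉ R := fun hx => by
          have := hd.root x hx
          omega
        let v : V(G) := ⟨x, (hl.mono hle).left_mem⟩
        refine ⟨v, (p v hxR).1, (p v hxR).2, by simp [v, hxR], ?_⟩
        exact hd.unique (hp v hxR) (hph v hxR) hl hxy
      refine ⟨?_, hl.mono hle⟩
      rcases hd.step hl with hxy | hxy
      · exact key hl hxy
      · exact key hl.symm hxy
  · simp only [rootedSubgraph, Set.mem_ofPred_eq, dite_eq_left_iff, reduceCtorEq, imp_false,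
      not_not]
    exact ⟨fun ⟨_, hx⟩ => by simpa using hx, fun hx => ⟨hV ▸ hRV hx, by simpa using hx⟩⟩

theorem numRootedSpanningForests_eq_ncard_parentChoice (G : Graph α β) :
    G.numRootedSpanningForests =
      {g : V(G) → Option (E(G) × V(G)) | IsParentChoice g}.ncard := by
  rw [numRootedSpanningForests, ← injOn_rootedSubgraph.ncard_image]
  congr 1
  ext ⟨F, R⟩
  constructor
  · exact fun hF => IsRootedSpanningForest.exists_parentChoice hF
  · rintro ⟨g, hg, hgF⟩
    have := IsParentChoice.isRootedSpanningForest hg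
    rwa [hgF] at this

open Classical in
theorem natCast_numEdges (G : Graph α β) [Fintype E(G)] (R : Type*) [CommRing R] (x y : α) :
    (G.numEdges x y : R) = ∑ e : E(G), if G.IsLink e x y then 1 else 0 := by
  rw [Finset.sum_boole, numEdges, ← Set.ncard_coe_finset,
    ← Set.ncard_image_of_injective _ Subtype.val_injective]
  congr 2
  ext e
  constructor
  · exact fun he => ⟨⟨e, IsLink.edge_mem he⟩, by simpa using he, rfl⟩
  · rintro ⟨e, he, rfl⟩
    simpa using he

/-- The matrix forest theorem: the rooted spanning forests of a finite multigraph are counted by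
the determinant of `1 + L`, where `L` is the Laplacian. -/
theorem numRootedSpanningForests_eq_det [DecidableEq α] (G : Graph α β) [Fintype V(G)]
    (hE : E(G).Finite) (R : Type*) [CommRing R] [IsDomain R] :
    (G.numRootedSpanningForests : R) =
      (G.generalizedLaplacian fun v : V(G) => (G.deg v : R) + 1).det := by
  classical
  have : Fintype E(G) := hE.fintype
  -- Being a root has weight `1`; a pair `(e, y)` has weight `1` or `0` according to whether `e`
  -- joins `v` to `y`. The product of the weights thus tests the incidence condition of
  -- `IsParentChoice`.
  set c : V(G) → Option (E(G) × V(G)) → R := fun v o =>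
    o.elim 1 fun p => if G.IsLink p.1 v p.2 then 1 else 0 with hc
  have hmat : (G.generalizedLaplacian fun v : V(G) => (G.deg v : R) + 1) =
      Matrix.of fun v => ∑ o, c v o •
        (Pi.single v 1 - (o.map Prod.snd).elim 0 fun w => Pi.single w 1 : V(G) → R) := by
    ext v w
    simp only [generalizedLaplacian, adjacencyMatrix, Matrix.sub_apply, Matrix.of_apply, deg,
      Nat.cast_sum, natCast_numEdges, Fintype.sum_option, hc, Finset.sum_apply, Pi.add_apply,
      Fintype.sum_prod_type_right, Option.elim_none, Option.elim_some, Option.map_none,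
      Option.map_some, Pi.smul_apply, Pi.sub_apply, smul_eq_mul, mul_sub, Finset.sum_sub_distrib,
      Pi.single_apply, mul_ite, mul_one, mul_zero, Matrix.diagonal_apply, Pi.zero_apply]
    by_cases hvw : v = w
    · subst hvw
      simp
      ring
    · simp [hvw, Ne.symm hvw]
  rw [hmat, det_sum_smul_stepMatrix, numRootedSpanningForests_eq_ncard_parentChoice,
    Set.ncard_eq_toFinset_card', Set.toFinset_ofPred, ← Finset.sum_boole]
  refine Finset.sum_congr rfl fun g _ => ?_
  by_cases hl : ∀ v e y, g v = some (e, y) → G.IsLink e v y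
  · have h1 : ∏ v, c v (g v) = 1 := by
      refine Finset.prod_eq_one fun v _ => ?_
      rcases hv : g v with _ | ⟨e, y⟩
      · rfl
      · simp [hc, hl v e y hv]
    rw [h1, one_mul]
    exact if_congr ⟨fun h => h.2, fun h => ⟨hl, h⟩⟩ rfl rfl
  · rw [if_neg fun h => hl h.1]
    push Not at hl
    obtain ⟨v, e, y, hv, hl⟩ := hl
    rw [Finset.prod_eq_zero (Finset.mem_univ v) (by simp [hc, hv, hl]), zero_mul]

end Graph

end

/-! ### Fourier analysis on `ZMod n` and circulant graphs. -/

noncomputable section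

namespace Graph

section Fourier

variable {n : ℕ} [NeZero n]

/-- `cos (2 π j / n)`, by means of the standard additive character. -/
def cosNode (j : ZMod n) : ℂ := (ZMod.stdAddChar j + ZMod.stdAddChar (-j)) / 2

theorem eval_chebyshevT_of_mul_eq_one (k : ℕ) {x y : ℂ} (hxy : x * y = 1) :
    (Polynomial.Chebyshev.T ℂ k).eval ((x + y) / 2) = (x ^ k + y ^ k) / 2 := by
  have hx : x ≠ 0 := left_ne_zero_of_mul_eq_one hxy
  obtain rfl : y = x⁻¹ := eq_inv_of_mul_eq_one_right hxy
  have h := Polynomial.Chebyshev.T_complex_cosh (Complex.log x) k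
  rw [Complex.cosh, Complex.cosh, Complex.exp_neg, Complex.exp_log hx, Complex.exp_neg] at h
  have : Complex.exp ((k : ℤ) * Complex.log x) = x ^ k := by
    rw [Int.cast_natCast, Complex.exp_nat_mul, Complex.exp_log hx]
  rw [this] at h
  rw [h, inv_pow]

theorem stdAddChar_mul_stdAddChar_neg (j : ZMod n) :
    (ZMod.stdAddChar j : ℂ) * ZMod.stdAddChar (-j) = 1 := by
  rw [← AddChar.map_add_eq_mul, add_neg_cancel, AddChar.map_zero_eq_one]

theorem eval_chebyshevT_cosNode (s : ℕ) (j : ZMod n) :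
    2 * (Polynomial.Chebyshev.T ℂ s).eval (cosNode j) =
      ZMod.stdAddChar (j * (s : ZMod n)) + ZMod.stdAddChar (-(j * (s : ZMod n))) := by
  rw [cosNode, eval_chebyshevT_of_mul_eq_one s (stdAddChar_mul_stdAddChar_neg j),
    ← AddChar.map_nsmul_eq_pow, ← AddChar.map_nsmul_eq_pow, nsmul_eq_mul, nsmul_eq_mul, mul_neg,
    mul_comm (s : ZMod n)]
  ring

theorem prod_sub_stdAddChar (z : ℂ) : ∏ j : ZMod n, (z - ZMod.stdAddChar j) = z ^ n - 1 := by
  have hn : 0 < n := NeZero.pos n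
  have hprim := Complex.isPrimitiveRoot_exp n hn.ne'
  have himage : Finset.univ.image (fun j : ZMod n => (ZMod.stdAddChar j : ℂ)) =
      Polynomial.nthRootsFinset n (1 : ℂ) := by
    refine Finset.eq_of_subset_of_card_le (fun x hx => ?_) ?_
    · obtain ⟨j, -, rfl⟩ := Finset.mem_image.mp hx
      rw [Polynomial.mem_nthRootsFinset hn, ← AddChar.map_nsmul_eq_pow, nsmul_eq_mul,
        ZMod.natCast_self, zero_mul, AddChar.map_zero_eq_one]
    · rw [hprim.card_nthRootsFinset, Finset.card_image_of_injective _ ZMod.injective_stdAddChar,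
        Finset.card_univ, ZMod.card]
  have := congrArg (Polynomial.eval z) (Polynomial.X_pow_sub_one_eq_prod hn hprim)
  rw [← himage, Finset.prod_image fun _ _ _ _ h => ZMod.injective_stdAddChar h] at this
  simpa [Polynomial.eval_prod] using this.symm

/-- The factorization of `2 T_n - 2`. -/
theorem two_mul_chebyshevT_sub_two (w : ℂ) :
    2 * (Polynomial.Chebyshev.T ℂ (n : ℤ)).eval w - 2 =
      2 ^ n * ∏ j : ZMod n, (w - cosNode j) := by
  obtain ⟨θ, rfl⟩ := Complex.cos_surjective w
  set x := Complex.exp (θ * Complex.I) with hx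
  set y := Complex.exp (-θ * Complex.I) with hy
  have hxy : x * y = 1 := by rw [hx, hy, ← Complex.exp_add]; simp
  -- With `w = (x + y) / 2` and `x y = 1`, each factor splits over `ζ^j` and `ζ^(-j)`; the whole
  -- product is `(x^n - 1)^2 y^n = x^n + y^n - 2`.
  have hfac : ∀ j : ZMod n, 2 * ((x + y) / 2 - cosNode j) =
      (x - ZMod.stdAddChar j) * (x - ZMod.stdAddChar (-j)) * y := by
    intro j
    have := stdAddChar_mul_stdAddChar_neg j
    rw [cosNode]
    linear_combination (-x + ZMod.stdAddChar j + ZMod.stdAddChar (-j)) * hxy - y * this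
  have hcard : Finset.card (Finset.univ : Finset (ZMod n)) = n := by
    rw [Finset.card_univ, ZMod.card]
  have hneg : ∏ j : ZMod n, (x - ZMod.stdAddChar (-j)) = x ^ n - 1 :=
    (Equiv.prod_comp (Equiv.neg (ZMod n)) fun j => x - ZMod.stdAddChar j).trans
      (prod_sub_stdAddChar x)
  have hpow : (2 : ℂ) ^ n = ∏ _j : ZMod n, 2 := by rw [Finset.prod_const, hcard]
  have hxyn : x ^ n * y ^ n = 1 := by rw [← mul_pow, hxy, one_pow]
  change 2 * (Polynomial.Chebyshev.T ℂ (n : ℤ)).eval ((x + y) / 2) - 2 =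
    2 ^ n * ∏ j : ZMod n, ((x + y) / 2 - cosNode j)
  rw [hpow, ← Finset.prod_mul_distrib, Finset.prod_congr rfl fun j _ => hfac j,
    Finset.prod_mul_distrib, Finset.prod_mul_distrib, prod_sub_stdAddChar, hneg,
    Finset.prod_const, hcard, eval_chebyshevT_of_mul_eq_one n hxy]
  linear_combination (2 - x ^ n) * hxyn

open scoped Kronecker in
/-- A block circulant matrix is block diagonalized by the discrete Fourier transform. -/
theorem det_eq_prod_det_of_fourier {V : Type*} [Fintype V] [DecidableEq V]
    (M : Matrix (V × ZMod n) (V × ZMod n) ℂ) (D : ZMod n → Matrix V V ℂ)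
    (hMD : ∀ v w k j, ∑ l, M (v, k) (w, l) * ZMod.stdAddChar (j * l) =
      ZMod.stdAddChar (j * k) * D j v w) :
    M.det = ∏ j, (D j).det := by
  set Ψ : Matrix (ZMod n) (ZMod n) ℂ := Matrix.of fun l j => ZMod.stdAddChar (j * l) with hΨ
  set Ψ' : Matrix (ZMod n) (ZMod n) ℂ := Matrix.of fun j m => ZMod.stdAddChar (-(j * m)) with hΨ'
  -- Orthogonality of characters; it is needed only to see that `Ψ` is invertible.
  have hinv : Ψ * Ψ' = (n : ℂ) • (1 : Matrix (ZMod n) (ZMod n) ℂ) := by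
    ext l m
    have : ∀ j : ZMod n, Ψ l j * Ψ' j m = ZMod.stdAddChar (j * (l - m)) := fun j => by
      rw [hΨ, hΨ', Matrix.of_apply, Matrix.of_apply, ← AddChar.map_add_eq_mul]
      ring_nf
    rw [Matrix.mul_apply, Finset.sum_congr rfl fun j _ => this j,
      AddChar.sum_mulShift _ (ZMod.isPrimitive_stdAddChar n), ZMod.card]
    simp [Matrix.one_apply, sub_eq_zero]
  have hdet : Ψ.det ≠ 0 := by
    intro h0
    have := congrArg Matrix.det hinv
    rw [Matrix.det_mul, h0, zero_mul, Matrix.det_smul, Matrix.det_one, mul_one] at this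
    exact pow_ne_zero _ (Nat.cast_ne_zero.mpr (NeZero.ne n)) this.symm
  have hP : ((1 : Matrix V V ℂ) ⊗ₖ Ψ).det ≠ 0 := by
    rw [Matrix.det_kronecker, Matrix.det_one, one_pow, one_mul]
    exact pow_ne_zero _ hdet
  have hcomm : M * ((1 : Matrix V V ℂ) ⊗ₖ Ψ) =
      ((1 : Matrix V V ℂ) ⊗ₖ Ψ) * Matrix.blockDiagonal D := by
    ext ⟨v, k⟩ ⟨w, j⟩
    simp only [Matrix.mul_apply, Fintype.sum_prod_type, Matrix.kroneckerMap_apply,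
      Matrix.one_apply, Matrix.blockDiagonal_apply]
    refine Eq.trans ?_ ((hMD v w k j).trans ?_)
    · rw [Finset.sum_eq_single w (fun b _ hb => by simp [hb]) (by simp)]
      simp [hΨ]
    · rw [Finset.sum_eq_single v (fun b _ hb => by simp [Ne.symm hb]) (by simp),
        Finset.sum_eq_single j (fun b _ hb => by simp [hb]) (by simp)]
      simp [hΨ]
  have := congrArg Matrix.det hcomm
  rw [Matrix.det_mul, Matrix.det_mul, Matrix.det_blockDiagonal, mul_comm] at this
  exact mul_left_cancel₀ hP this

end Fourier

section Circulant

variable {n : ℕ} [NeZero n] {J : Finset ℕ}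

open Classical in
-- Since `1 ≤ s` and `2 * s < n`, the residues `s` and `-s` for `s ∈ J` are nonzero and pairwise
-- distinct, so no neighbour is counted twice.
theorem sum_circulant_adj {R : Type*} [CommRing R] (hJ : ∀ s ∈ J, 1 ≤ s) (hn : ∀ s ∈ J, 2 * s < n)
    (k : ZMod n) (f : ZMod n → R) :
    ∑ l, (if (circulant n J).Adj k l then f l else 0) = ∑ s ∈ J, (f (k + s) + f (k - s)) := by
  have hcast : ∀ s ∈ J, ∀ t ∈ J, (s : ZMod n) = t → s = t := by
    intro s hs t ht hst
    have h₁ := hn s hs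
    have h₂ := hn t ht
    have := congrArg ZMod.val hst
    rwa [ZMod.val_natCast_of_lt (by omega), ZMod.val_natCast_of_lt (by omega)] at this
  have hsum : ∀ s ∈ J, ∀ t ∈ J, (s : ZMod n) + t ≠ 0 := by
    intro s hs t ht h0
    have h₁ := hn s hs
    have h₂ := hn t ht
    have h₃ := hJ s hs
    rw [← Nat.cast_add, ZMod.natCast_eq_zero_iff] at h0
    have := Nat.le_of_dvd (by omega) h0
    omega
  have hset : Finset.univ.filter ((circulant n J).Adj k) =
      J.image (fun s : ℕ => k + (s : ZMod n)) ∪ J.image (fun s : ℕ => k - (s : ZMod n)) := by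
    ext l
    rw [Finset.mem_filter, and_iff_right (Finset.mem_univ l)]
    simp only [circulant, SimpleGraph.circulantGraph_adj, Finset.mem_union, Finset.mem_image,
      Set.mem_image, Finset.mem_coe]
    constructor
    · rintro ⟨-, ⟨s, hs, h⟩ | ⟨s, hs, h⟩⟩
      · exact .inr ⟨s, hs, by rw [h]; ring⟩
      · exact .inl ⟨s, hs, by rw [h]; ring⟩
    · have hne : ∀ s ∈ J, (s : ZMod n) ≠ 0 := by
        intro s hs h0
        exact hsum s hs s hs (by rw [h0, add_zero])
      rintro (⟨s, hs, rfl⟩ | ⟨s, hs, rfl⟩)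
      · exact ⟨by simpa using hne s hs, .inr ⟨s, hs, by ring⟩⟩
      · exact ⟨fun h => hne s hs (by linear_combination h), .inl ⟨s, hs, by ring⟩⟩
  rw [← Finset.sum_filter, hset, Finset.sum_union, Finset.sum_image, Finset.sum_image,
    Finset.sum_add_distrib]
  · intro s hs t ht h
    exact hcast s hs t ht (by simpa using h)
  · intro s hs t ht h
    exact hcast s hs t ht (by simpa using h)
  · rw [Finset.disjoint_left]
    intro l hl hl'
    obtain ⟨s, hs, rfl⟩ := Finset.mem_image.mp hl
    obtain ⟨t, ht, h⟩ := Finset.mem_image.mp hl'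
    exact hsum s hs t ht (by linear_combination -h)

end Circulant

end Graph

end

/-! ### The Laplacian of a circulant foliation. -/

noncomputable section

namespace Graph

variable {α β : Type*} (H : Graph α β) (n : ℕ) (S : α → Finset ℕ)

open Classical in
theorem numEdges_circulantFoliation (hE : E(H).Finite) (v w : V(H)) (k l : ZMod n) :
    (H.circulantFoliation n S).numEdges (k, v) (l, w) =
      (if k = l then H.numEdges v w else 0) +
        if v = w ∧ (circulant n (S v)).Adj k l then 1 else 0 := by
  set A : Set ((ZMod n × β) ⊕ (α × Sym2 (ZMod n))) :=
    (fun e => Sum.inl (k, e)) '' {e | k = l ∧ H.IsLink e v w} with hA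
  set B : Set ((ZMod n × β) ⊕ (α × Sym2 (ZMod n))) :=
    if v = w ∧ (circulant n (S v)).Adj k l then {Sum.inr (v.1, s(k, l))} else ∅ with hB
  have hAB : {e | (H.circulantFoliation n S).IsLink e (k, v.1) (l, w.1)} = A ∪ B := by
    ext (⟨i, e⟩ | ⟨u, z⟩)
    · have : Sum.inl (i, e) ∉ B := by
        rw [hB]
        split_ifs <;> simp
      simp only [circulantFoliation, foliation, Set.mem_ofPred_eq, Set.mem_union, this, or_false,
        hA, Set.mem_image, Sum.inl.injEq, Prod.mk.injEq]
      grind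
    · have : Sum.inr (u, z) ∉ A := by simp [hA]
      rw [Set.mem_union, or_iff_right this, hB]
      change u ∈ V(H) ∧ v.1 = u ∧ w.1 = u ∧ z = s(k, l) ∧ (circulant n (S u)).Adj k l ↔ _
      split_ifs with h
      · obtain ⟨rfl, h⟩ := h
        simp only [Set.mem_singleton_iff, Sum.inr.injEq, Prod.mk.injEq]
        constructor
        · rintro ⟨-, rfl, -, rfl, -⟩
          exact ⟨rfl, rfl⟩
        · rintro ⟨rfl, rfl⟩
          exact ⟨v.2, rfl, rfl, rfl, h⟩
      · simp only [Set.mem_empty_iff_false, iff_false]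
        rintro ⟨-, rfl, hwv, -, hadj⟩
        exact h ⟨Subtype.ext hwv.symm, hadj⟩
  have hinj : Function.Injective fun e : β =>
      (Sum.inl (k, e) : (ZMod n × β) ⊕ (α × Sym2 (ZMod n))) :=
    fun e e' h => by simpa using h
  have hAfin : A.Finite := (hE.subset fun e he => IsLink.edge_mem he.2).image _
  have hBfin : B.Finite := by
    rw [hB]
    split_ifs <;> simp
  have hdisj : Disjoint A B := by
    rw [Set.disjoint_left]
    rintro _ ⟨e, -, rfl⟩
    rw [hB]
    split_ifs <;> simp
  rw [numEdges, hAB, Set.ncard_union_eq hdisj hAfin hBfin, hA, hinj.injOn.ncard_image]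
  congr 1
  · split_ifs with hkl <;> simp [hkl, numEdges]
  · rw [hB]
    split_ifs <;> simp

theorem finite_edgeSet_circulantFoliation [NeZero n] [Finite V(H)] (hE : E(H).Finite) :
    E(H.circulantFoliation n S).Finite := by
  refine (((Set.finite_univ (α := ZMod n)).prod hE).image Sum.inl |>.union
    (((Set.toFinite V(H)).prod (Set.finite_univ (α := Sym2 (ZMod n)))).image Sum.inr)).subset ?_
  rintro (⟨k, e⟩ | ⟨v, z⟩) he
  · obtain ⟨x, y, hxy⟩ := exists_isLink_of_mem_edgeSet he
    exact .inl ⟨_, ⟨Set.mem_univ _, hxy.2.2.edge_mem⟩, rfl⟩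
  · obtain ⟨x, y, hxy⟩ := exists_isLink_of_mem_edgeSet he
    exact .inr ⟨_, ⟨hxy.1, Set.mem_univ _⟩, rfl⟩

/-- The vertices of the foliation, indexed by the vertices of the base and the levels. -/
def circulantFoliationVertexEquiv : V(H) × ZMod n ≃ V(H.circulantFoliation n S) where
  toFun p := ⟨(p.2, p.1), p.1.2⟩
  invFun q := (⟨q.1.2, q.2⟩, q.1.1)
  left_inv _ := rfl
  right_inv _ := rfl

variable {H n S}

theorem deg_circulantFoliation [NeZero n] [Fintype V(H)] [Fintype V(H.circulantFoliation n S)]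
    (hE : E(H).Finite) (hS : ∀ v ∈ V(H), ∀ s ∈ S v, 1 ≤ s)
    (hn : ∀ v ∈ V(H), ∀ s ∈ S v, 2 * s < n) (v : V(H)) (k : ZMod n) :
    ((H.circulantFoliation n S).deg (k, v) : ℂ) = H.deg v + 2 * (S v).card := by
  classical
  rw [deg, ← Equiv.sum_comp (circulantFoliationVertexEquiv H n S), Nat.cast_sum]
  have h1 : ∀ p : V(H) × ZMod n, (((H.circulantFoliation n S).numEdges (k, v)
      (circulantFoliationVertexEquiv H n S p) : ℕ) : ℂ) =
      (if k = p.2 then (H.numEdges v p.1 : ℂ) else 0) +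
        if v = p.1 ∧ (circulant n (S v)).Adj k p.2 then 1 else 0 := fun p => by
    have := numEdges_circulantFoliation H n S hE v p.1 k p.2
    exact (congrArg (Nat.cast (R := ℂ)) this).trans (by push_cast; rfl)
  have h2 := sum_circulant_adj (hS v v.2) (hn v v.2) k fun _ => (1 : ℂ)
  rw [Finset.sum_congr rfl fun p _ => h1 p, Fintype.sum_prod_type, deg, Nat.cast_sum]
  simp only [Finset.sum_add_distrib, Finset.sum_ite_eq, Finset.mem_univ, if_true, ite_and]
  congr 1
  rw [Finset.sum_eq_single v (fun b _ hb => by simp [Ne.symm hb]) (by simp)]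
  simp only [if_true, h2]
  simp
  ring

/-- The eigenvalue decomposition for the rooted spanning forests of a circulant foliation. -/
theorem numRootedSpanningForests_circulantFoliation [NeZero n] [DecidableEq α] [Fintype V(H)]
    (hE : E(H).Finite) (hS : ∀ v ∈ V(H), ∀ s ∈ S v, 1 ≤ s)
    (hn : ∀ v ∈ V(H), ∀ s ∈ S v, 2 * s < n) :
    ((H.circulantFoliation n S).numRootedSpanningForests : ℂ) =
      ∏ j : ZMod n, Polynomial.aeval (cosNode j) (H.Q S) := by
  classical
  let φ := circulantFoliationVertexEquiv H n S
  have : Fintype V(H.circulantFoliation n S) := Fintype.ofEquiv _ φ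
  rw [numRootedSpanningForests_eq_det _ (finite_edgeSet_circulantFoliation H n S hE) ℂ,
    ← Matrix.det_submatrix_equiv_self φ]
  -- The diagonal entries of `L(H, W)` evaluated at the node `cosNode j`.
  set d : ZMod n → V(H) → ℂ := fun j v => 2 * (S v).card + H.deg v + 1 -
    ∑ s ∈ S v, 2 * (Polynomial.Chebyshev.T ℂ (s : ℤ)).eval (cosNode j) with hd
  rw [det_eq_prod_det_of_fourier _ fun j => H.generalizedLaplacian (d j)]
  · refine Finset.prod_congr rfl fun j _ => ?_
    rw [Q, AlgHom.map_det]
    congr 1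
    ext v w
    simp only [generalizedLaplacian, adjacencyMatrix, AlgHom.mapMatrix_apply, Matrix.map_apply,
      Matrix.sub_apply, Matrix.diagonal_apply, Matrix.of_apply, map_sub, map_natCast, hd]
    split_ifs
    · simp [Polynomial.Chebyshev.aeval_T, map_ofNat]
    · simp
  · intro v w k j
    have hentry : ∀ l : ZMod n, ((H.circulantFoliation n S).generalizedLaplacian fun v =>
        ((H.circulantFoliation n S).deg v : ℂ) + 1).submatrix φ φ (v, k) (w, l) =
        (if k = l then (if v = w then (H.deg v + 2 * (S v).card + 1 : ℂ) else 0) -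
          H.numEdges v w else 0) -
          if v = w then (if (circulant n (S v)).Adj k l then 1 else 0) else 0 := by
      intro l
      have hdeg := deg_circulantFoliation hE hS hn v k
      have hnum := numEdges_circulantFoliation H n S hE v w k l
      have hφ : φ (v, k) = φ (w, l) ↔ v = w ∧ k = l := by
        rw [φ.injective.eq_iff, Prod.mk.injEq]
      simp only [generalizedLaplacian, adjacencyMatrix, Matrix.submatrix_apply, Matrix.sub_apply,
        Matrix.diagonal_apply, Matrix.of_apply, hφ]
      change (if v = w ∧ k = l then ((H.circulantFoliation n S).deg (k, v.1) : ℂ) + 1 else 0) -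
        ((H.circulantFoliation n S).numEdges (k, v.1) (l, w.1) : ℂ) = _
      rw [hdeg, hnum]
      by_cases hvw : v = w <;> by_cases hkl : k = l <;> simp [hvw, hkl]
    have hchar := sum_circulant_adj (hS v v.2) (hn v v.2) k
      fun l => (ZMod.stdAddChar (j * l) : ℂ)
    have hcheb : ∑ s ∈ S v, ((ZMod.stdAddChar (j * (k + (s : ZMod n))) : ℂ) +
        ZMod.stdAddChar (j * (k - (s : ZMod n)))) = ZMod.stdAddChar (j * k) *
          ∑ s ∈ S v, 2 * (Polynomial.Chebyshev.T ℂ (s : ℤ)).eval (cosNode j) := by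
      rw [Finset.mul_sum]
      refine Finset.sum_congr rfl fun s _ => ?_
      rw [eval_chebyshevT_cosNode, mul_add, mul_sub, sub_eq_add_neg, AddChar.map_add_eq_mul,
        AddChar.map_add_eq_mul, mul_add]
    rw [Finset.sum_congr rfl fun l _ => by rw [hentry l]]
    simp only [generalizedLaplacian, adjacencyMatrix, Matrix.sub_apply, Matrix.diagonal_apply,
      Matrix.of_apply, hd, sub_mul, Finset.sum_sub_distrib, ite_mul, zero_mul, one_mul,
      Finset.sum_ite_eq, Finset.mem_univ, if_true]
    by_cases hvw : v = w
    · simp only [hvw, if_true] at hchar hcheb ⊢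
      rw [hchar, hcheb]
      ring
    · simp only [hvw, if_false, Finset.sum_const_zero]
      ring

end Graph

end

/-! ### Degree and leading coefficient of `Q`, and positivity of `eta`. -/

noncomputable section

namespace Graph

open Polynomial

theorem _root_.Polynomial.coeff_prod_sum_of_natDegree_le {ι R : Type*} [CommSemiring R]
    (s : Finset ι) (f : ι → R[X]) (m : ι → ℕ) (hf : ∀ i ∈ s, (f i).natDegree ≤ m i) :
    (∏ i ∈ s, f i).coeff (∑ i ∈ s, m i) = ∏ i ∈ s, (f i).coeff (m i) := by
  classical
  induction s using Finset.induction_on with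
  | empty => simp
  | insert a s ha ih =>
    have hs : (∏ i ∈ s, f i).natDegree ≤ ∑ i ∈ s, m i :=
      (natDegree_prod_le s f).trans
        (Finset.sum_le_sum fun i hi => hf i (Finset.mem_insert_of_mem hi))
    rw [Finset.prod_insert ha, Finset.sum_insert ha, Finset.prod_insert ha,
      coeff_mul_add_eq_of_natDegree_le (hf a (Finset.mem_insert_self a s)) hs,
      ih fun i hi => hf i (Finset.mem_insert_of_mem hi)]

/-- If the rows of a polynomial matrix have degrees at most `m`, then the degree of its determinant
is at most `∑ m`, and the coefficient there is the determinant of the coefficients. -/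
theorem _root_.Matrix.natDegree_det_le_sum {V R : Type*} [Fintype V] [DecidableEq V] [CommRing R]
    (M : Matrix V V R[X]) (m : V → ℕ) (hM : ∀ v w, (M v w).natDegree ≤ m v) :
    M.det.natDegree ≤ ∑ v, m v ∧
      M.det.coeff (∑ v, m v) = (Matrix.of fun v w => (M v w).coeff (m v)).det := by
  -- After transposing, the product for `σ` is `∏ M v (σ v)`, indexed by rows, which is where the
  -- degree bounds live.
  rw [← M.det_transpose, ← Matrix.det_transpose (Matrix.of _), Matrix.det_apply, Matrix.det_apply]
  constructor
  · refine natDegree_sum_le_of_forall_le _ _ fun σ _ => (natDegree_smul_le _ _).trans ?_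
    exact (natDegree_prod_le _ _).trans (Finset.sum_le_sum fun v _ => hM v _)
  · rw [finsetSum_coeff]
    refine Finset.sum_congr rfl fun σ _ => ?_
    rw [coeff_smul]
    exact congrArg _ (coeff_prod_sum_of_natDegree_le Finset.univ (fun v => M v (σ v)) m
      fun v _ => hM v _)

section Jumps

variable {J : Finset ℕ}

theorem natDegree_sum_chebyshevT_le :
    (∑ s ∈ J, 2 * Chebyshev.T ℤ (s : ℤ)).natDegree ≤ J.sup id := by
  refine natDegree_sum_le_of_forall_le _ _ fun s hs => ?_
  refine natDegree_mul_le.trans ?_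
  rw [natDegree_ofNat, zero_add, Chebyshev.natDegree_T]
  exact Finset.le_sup (f := id) hs

/-- Only the largest jump `t` reaches this degree, and `T_t` has leading coefficient `2 ^ (t - 1)`
because `t ≥ 1`. -/
theorem coeff_sum_chebyshevT (hJ : ∀ s ∈ J, 1 ≤ s) (hne : J.Nonempty) :
    (∑ s ∈ J, 2 * Chebyshev.T ℤ (s : ℤ)).coeff (J.sup id) = 2 ^ J.sup id := by
  obtain ⟨t, ht, hmax⟩ := Finset.exists_mem_eq_sup J hne id
  rw [hmax, finsetSum_coeff, Finset.sum_eq_single t]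
  · have h := Chebyshev.leadingCoeff_T ℤ (t : ℤ)
    rw [leadingCoeff, Chebyshev.natDegree_T, Int.natAbs_natCast] at h
    have := hJ t ht
    rw [← C_ofNat, coeff_C_mul, id, h, ← pow_succ', Nat.sub_add_cancel this]
  · intro s hs hst
    have hle : id s ≤ id t := hmax ▸ Finset.le_sup (f := id) hs
    refine coeff_eq_zero_of_natDegree_lt (natDegree_mul_le.trans_lt ?_)
    rw [natDegree_ofNat, zero_add, Chebyshev.natDegree_T]
    exact lt_of_le_of_ne hle hst
  · exact fun h => absurd ht h

end Jumps

variable {α β : Type*} [DecidableEq α] (H : Graph α β) [Fintype V(H)] (S : α → Finset ℕ)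

open Classical in
/-- `Q` has degree at most `sumMaxJumps`, and the absolute value of its coefficient there. -/
theorem natDegree_Q_le_and_coeff (hS : ∀ v ∈ V(H), ∀ s ∈ S v, 1 ≤ s) :
    (H.Q S).natDegree ≤ H.sumMaxJumps S ∧
      |(H.Q S).coeff (H.sumMaxJumps S)| = 2 ^ H.sumMaxJumps S * |H.eta S| := by
  set d : V(H) → ℤ[X] := fun v =>
    2 * ((S v).card : ℤ[X]) + (H.deg v : ℤ[X]) + 1 - ∑ s ∈ S v, 2 * Chebyshev.T ℤ (s : ℤ) with hd
  have hconst : ∀ v : V(H), (2 * ((S v).card : ℤ[X]) + (H.deg v : ℤ[X]) + 1) =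
      C (2 * ((S v).card : ℤ) + H.deg v + 1) := fun v => by simp
  have hentry : ∀ v w : V(H), H.generalizedLaplacian d v w =
      (if v = w then d v else 0) - C (H.numEdges v w : ℤ) := fun v w => by
    simp [generalizedLaplacian, adjacencyMatrix, Matrix.diagonal_apply]
  have hddeg : ∀ v, (d v).natDegree ≤ (S v).sup id := fun v => by
    rw [hd]
    dsimp only
    rw [hconst]
    exact (natDegree_sub_le_of_le (natDegree_C _).le natDegree_sum_chebyshevT_le).trans (by simp)
  obtain ⟨hle, hcoeff⟩ := Matrix.natDegree_det_le_sum (H.generalizedLaplacian d)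
    (fun v => (S v).sup id) fun v w => by
      rw [hentry]
      refine (natDegree_sub_le_of_le (m := (S v).sup id) ?_ (natDegree_C _).le).trans (by simp)
      split_ifs
      · exact hddeg v
      · simp
  refine ⟨hle, ?_⟩
  change |(H.generalizedLaplacian d).det.coeff (∑ v : V(H), (S v).sup id)| = _
  rw [hcoeff]
  set N : Matrix V(H) V(H) ℤ :=
    Matrix.of fun v w => (H.generalizedLaplacian d v w).coeff ((S v).sup id) with hN
  have hNne : ∀ v w : V(H), S v ≠ ∅ → N v w = if v = w then -2 ^ (S v).sup id else 0 := by
    intro v w hv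
    have hne := Finset.nonempty_iff_ne_empty.mpr hv
    have hpos : (S v).sup id ≠ 0 := by
      obtain ⟨s, hs⟩ := hne
      have h₁ : s ≤ (S v).sup id := Finset.le_sup (f := id) hs
      have h₂ := hS v v.2 s hs
      omega
    rw [hN, Matrix.of_apply, hentry, coeff_sub, coeff_C, if_neg hpos, sub_zero]
    split_ifs with hvw
    · rw [hd]
      dsimp only
      rw [hconst, coeff_sub, coeff_C, if_neg hpos, coeff_sum_chebyshevT (hS v v.2) hne, zero_sub]
    · simp
  have hNe : ∀ v w : V(H), S v = ∅ → N v w = (if v = w then (H.deg v : ℤ) + 1 else 0) -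
      H.numEdges v w := by
    intro v w hv
    rw [hN, Matrix.of_apply, hentry, hv]
    split_ifs <;> simp [hd, hv]
  -- A row over a nonempty fibre keeps only its diagonal entry in top degree, whereas a row over an
  -- empty fibre is constant and keeps all its entries. Hence `N` is block triangular, with a
  -- diagonal block of powers of two up to sign and the matrix of `eta`.
  have hdet := N.twoBlockTriangular_det' (fun v : V(H) => S v ≠ ∅) fun v hv w hw => by
    rw [hNne v w hv, if_neg]
    rintro rfl
    exact hw hv
  have hfirst : N.toSquareBlockProp (fun v : V(H) => S v ≠ ∅) =
      Matrix.diagonal fun v => -2 ^ (S v.1).sup id := by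
    ext ⟨v, hv⟩ ⟨w, hw⟩
    simp [Matrix.toSquareBlockProp_def, hNne v w hv, Matrix.diagonal_apply]
  let φ : V(H.emptyFibreSubgraph S) ≃ {v : V(H) // ¬ S v ≠ ∅} :=
    { toFun := fun v => ⟨⟨v, v.2.1⟩, not_not.mpr v.2.2⟩
      invFun := fun v => ⟨v, v.1.2, not_not.mp v.2⟩
      left_inv := fun _ => rfl
      right_inv := fun _ => rfl }
  have hsecond : (N.toSquareBlockProp fun v : V(H) => ¬ S v ≠ ∅).det = H.eta S := by
    rw [← Matrix.det_submatrix_equiv_self φ, eta]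
    congr 1
    ext v w
    have hv : S v = ∅ := v.2.2
    have hnum : (H.emptyFibreSubgraph S).numEdges v w = H.numEdges v w := by
      rw [numEdges, numEdges]
      congr 1
      ext e
      exact ⟨fun he => he.1, fun he => ⟨he, v.2, w.2⟩⟩
    have hvw : (φ v).1 = (φ w).1 ↔ v = w := by
      rw [Subtype.val_inj, φ.injective.eq_iff]
    simp only [Matrix.submatrix_apply, Matrix.toSquareBlockProp_def, Matrix.of_apply,
      generalizedLaplacian, adjacencyMatrix, Matrix.sub_apply, Matrix.diagonal_apply, hnum]
    rw [hNe _ _ hv, if_congr hvw rfl rfl]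
    rfl
  rw [hdet, hfirst, hsecond, Matrix.det_diagonal, abs_mul, Finset.abs_prod]
  congr 1
  simp only [abs_neg, abs_pow, abs_two]
  rw [Finset.prod_pow_eq_pow_sum, sumMaxJumps]
  congr 1
  rw [← Finset.sum_filter_of_ne (p := fun v : V(H) => S v ≠ ∅)
    fun v _ hv h0 => hv (by rw [h0]; rfl)]
  exact (Finset.sum_subtype (Finset.univ.filter fun v : V(H) => S v ≠ ∅)
    (p := fun v : V(H) => S v ≠ ∅) (fun v => by simp) fun v : V(H) => (S v).sup id).symm

/-- `eta` is a sum of nonnegative terms over partial functions, and the term of the empty partial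
function is positive. -/
theorem eta_pos : 0 < H.eta S := by
  classical
  set H' := H.emptyFibreSubgraph S with hH'
  -- The weight of `none` is one plus the number of edges from `v` to vertices with nonempty fibre,
  -- hence at least `1`.
  set c : V(H') → Option V(H') → ℤ := fun v o =>
    o.elim (H.deg v + 1 - ∑ y : V(H'), (H.numEdges v y : ℤ)) fun y => H.numEdges v y with hc
  have hnum : ∀ v w : V(H'), H'.numEdges v w = H.numEdges v w := by
    intro v w
    rw [numEdges, numEdges]
    congr 1
    ext e
    exact ⟨fun he => he.1, fun he => ⟨he, v.2, w.2⟩⟩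
  have hle : ∀ v : V(H'), ∑ y : V(H'), (H.numEdges v y : ℤ) ≤ H.deg v := by
    intro v
    rw [deg, Nat.cast_sum]
    let φ : V(H') ↪ V(H) := ⟨fun y => ⟨y, y.2.1⟩, fun _ _ h =>
      Subtype.ext (congrArg (fun x : V(H) => x.1) h)⟩
    calc ∑ y : V(H'), (H.numEdges v y : ℤ) = ∑ y ∈ Finset.univ.map φ, (H.numEdges v y : ℤ) := by
          rw [Finset.sum_map]
          rfl
      _ ≤ _ := Finset.sum_le_sum_of_subset_of_nonneg (Finset.subset_univ _)
          fun _ _ _ => Nat.cast_nonneg _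
  have hmat : (H'.generalizedLaplacian fun v => (H.deg v : ℤ) + 1) =
      Matrix.of fun v => ∑ o, c v o •
        (Pi.single v 1 - (id o).elim 0 fun w => Pi.single w 1 : V(H') → ℤ) := by
    ext v w
    simp only [generalizedLaplacian, adjacencyMatrix, Matrix.sub_apply, Matrix.of_apply, hnum,
      Fintype.sum_option, hc, Finset.sum_apply, Pi.add_apply, id,
      Option.elim_none, Option.elim_some, Pi.smul_apply, Pi.sub_apply, smul_eq_mul, mul_sub,
      Finset.sum_sub_distrib, Pi.single_apply, mul_ite, mul_one, mul_zero, Matrix.diagonal_apply,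
      Pi.zero_apply]
    by_cases hvw : v = w
    · subst hvw
      simp
    · simp [hvw, Ne.symm hvw]
  have hc0 : ∀ v o, 0 ≤ c v o := by
    rintro v (_ | y)
    · have := hle v
      simp only [hc, Option.elim_none]
      omega
    · exact Nat.cast_nonneg _
  rw [eta, hmat, det_sum_smul_stepMatrix]
  refine Finset.sum_pos' (fun g _ => mul_nonneg (Finset.prod_nonneg fun v _ => hc0 _ _) ?_)
    ⟨fun _ => none, Finset.mem_univ _, mul_pos (Finset.prod_pos fun v _ => ?_) ?_⟩
  · split_ifs <;> simp
  · have := hle v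
    simp only [hc, Option.elim_none]
    omega
  · rw [if_pos ⟨0, fun v => rfl⟩]
    exact one_pos

end Graph

end

/-! ### Products over the roots and the final formula. -/

noncomputable section

/-- Factor `p` over its complex roots at each `x j`, then exchange the products over `j` and over
the roots, as for a resultant. -/
theorem Polynomial.norm_prod_aeval_eq {ι : Type*} (s : Finset ι) (p : ℤ[X]) (x : ι → ℂ) :
    ‖∏ j ∈ s, aeval (x j) p‖ = |(p.leadingCoeff : ℝ)| ^ s.card *
      ((p.aroots ℂ).map fun w => ‖∏ j ∈ s, (w - x j)‖).prod := by
  have h : ∀ j, ‖aeval (x j) p‖ =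
      |(p.leadingCoeff : ℝ)| * ((p.aroots ℂ).map fun w => ‖w - x j‖).prod := by
    intro j
    rw [← eval_map_algebraMap, (IsAlgClosed.splits (p.map (algebraMap ℤ ℂ))).eval_eq_prod_roots,
      norm_mul, leadingCoeff_map_of_injective (algebraMap ℤ ℂ).injective_int, eq_intCast,
      Complex.norm_intCast]
    congr 1
    refine (map_multiset_prod (normHom (α := ℂ)) _).trans ?_
    rw [Multiset.map_map]
    exact congrArg _ (Multiset.map_congr rfl fun w _ => norm_sub_rev (x j) w)
  rw [norm_prod, Finset.prod_congr rfl fun j _ => h j, Finset.prod_mul_distrib,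
    Finset.prod_const]
  simp only [norm_prod]
  exact congrArg _ (Multiset.prod_map_prod_map s.val (p.aroots ℂ))


end

theorem theorem1 {α β : Type*} [DecidableEq α] (H : Graph α β) [Fintype V(H)]
    (hE : E(H).Finite) [H.Loopless] (hconn : H.Connected)
    (S : α → Finset ℕ) (hS : ∀ v ∈ V(H), ∀ s ∈ S v, 1 ≤ s) :
    0 < H.eta S ∧
    (H.Q S).degree = H.sumMaxJumps S ∧
    ((H.Q S).aroots ℂ).card = H.sumMaxJumps S ∧
    ∀ n : ℕ, 1 ≤ n → (∀ v ∈ V(H), ∀ s ∈ S v, 2 * s < n) →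
      ((H.circulantFoliation n S).numRootedSpanningForests : ℝ) =
        (H.eta S : ℝ) ^ n *
          (((H.Q S).aroots ℂ).map fun w : ℂ =>
            ‖2 * (Polynomial.Chebyshev.T ℂ (n : ℤ)).eval w - 2‖).prod := by
  have heta := H.eta_pos S
  obtain ⟨hle, hcoeff⟩ := H.natDegree_Q_le_and_coeff S hS
  rw [abs_of_pos heta] at hcoeff
  have hne : (H.Q S).coeff (H.sumMaxJumps S) ≠ 0 := by
    rw [← abs_pos, hcoeff]
    positivity
  have hnat : (H.Q S).natDegree = H.sumMaxJumps S :=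
    hle.antisymm (Polynomial.le_natDegree_of_ne_zero hne)
  have hQ : H.Q S ≠ 0 := by
    rintro h0
    simp [h0] at hne
  have hcard : ((H.Q S).aroots ℂ).card = H.sumMaxJumps S := by
    rw [Polynomial.aroots_def, ← (IsAlgClosed.splits _).natDegree_eq_card_roots,
      Polynomial.natDegree_map_eq_of_injective (algebraMap ℤ ℂ).injective_int, hnat]
  refine ⟨heta, (Polynomial.degree_eq_iff_natDegree_eq hQ).mpr hnat, hcard, fun n hn hSn => ?_⟩
  have : NeZero n := ⟨by omega⟩
  have hlead : |((H.Q S).leadingCoeff : ℝ)| = 2 ^ H.sumMaxJumps S * H.eta S := by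
    rw [Polynomial.leadingCoeff, hnat]
    exact_mod_cast hcoeff
  have hnode : ∀ w : ℂ, ‖2 * (Polynomial.Chebyshev.T ℂ (n : ℤ)).eval w - 2‖ =
      2 ^ n * ‖∏ j : ZMod n, (w - Graph.cosNode j)‖ := fun w => by
    rw [Graph.two_mul_chebyshevT_sub_two, norm_mul, norm_pow, Complex.norm_ofNat]
  -- The count is a natural number, so it equals the norm of its complex cast; knowing the leading
  -- coefficient up to sign is then enough.
  rw [← Complex.norm_natCast, Graph.numRootedSpanningForests_circulantFoliation hE hS hSn,
    Polynomial.norm_prod_aeval_eq, hlead, Finset.card_univ, ZMod.card]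
  -- The factor `2 ^ n` from each of the `sumMaxJumps` roots matches the power of two in the `n`-th
  -- power of the leading coefficient.
  simp only [hnode, Multiset.prod_map_mul, Multiset.map_const', Multiset.prod_replicate, hcard]
  ring
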